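/- A transducer $\mathcal{A}=(Q,A,\cdot,\circ)$ consists of a finite set of states $Q$, a finite alphabet $A$, and maps $(q,a)\mapsto q\cdot a\in Q$ and $(q,a)\mapsto q\circ a\in A$; it has the edges $q\xrightarrow{a|b}p$ with $p=q\cdot a$, $b=q\circ a$. Every state $q$ defines a map on finite words by $q\circ(a_1\cdots a_n)=(q\circ a_1)\,\bigl((q\cdot a_1)\circ(a_2\cdots a_n)\bigr)$. The transducer is bireversible if (1) for every $a\in A$ the map $q\mapsto q\cdot a$ is a permutation of $Q$; (2) for every $q\in Q$ the map $a\mapsto q\circ a$ is a permutation of $A$; (3) for every $b\in A$ and $p\in Q$ there is exactly one edge with output $b$ that ends in $p$. In this case the states act by automorphisms on the rooted tree $A^*$ of finite words, and $\mathcal{G}(\mathcal{A})$ denotes the group generated by these automorphisms. The dual transducer $\partial\mathcal{A}$ has state set $A$, alphabet $Q$, and an edge $a\xrightarrow{p|q}b$ for every edge $p\xrightarrow{a|b}q$ of $\mathcal{A}$; it is bireversible when $\mathcal{A}$ is, and $\mathcal{G}(\partial\mathcal{A})$ is defined in the same way. Let $\widetilde{A}=A\sqcup A^{-1}$. For a bireversible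 $\mathcal{A}$, the enriched transducer $\mathcal{A}^-$ over the alphabet $\widetilde{A}$ is obtained by adding to each edge $q\xrightarrow{a|b}p$ of $\mathcal{A}$ the edge $p\xrightarrow{a^{-1}|b^{-1}}q$. It is again invertible, and sending the automorphism of $A^*$ defined by $q\in Q$ to the automorphism of $\widetilde{A}^*$ defined by $q$ in $\mathcal{A}^-$ induces an isomorphism $\mathcal{G}(\mathcal{A})\cong\mathcal{G}(\mathcal{A}^-)$. Through it $\mathcal{G}(\mathcal{A})$ acts on the set $\widetilde{A}^\omega$ of right-infinite words over $\widetilde{A}$. Let $F_A$ be the free group on $A$, identified with the set of reduced words over $\widetilde{A}$, with the metric $d(u,v)=2^{-|u\wedge v|}$ for $u\ne v$, where $u\wedge v$ is the longest common prefix; its completion $\widehat{F_A}$ consists of the finite and the right-infinite reduced words, with the same metric. A word $\underline{u}\in\widetilde{A}^\omega$ is essentially non-trivial if the sequence of the reduced forms of its prefixes $\underline{u}[n]$, $n\ge 1$, has a subsequence that converges to an element of $\widehat{F_A}\setminus F_A$. **Corollary.** Let $\mathcal{A}=(Q,A,\cdot,\circ)$ be a bireversible transducer such that the group $G=\mathcal{G}(\mathcal{A})$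 is infinite. If the stabilizer $\mathrm{St}_G(\underline{u})$ is trivial for every essentially non-trivial $\underline{u}\in\widetilde{A}^\omega$, then $\mathcal{G}(\partial\mathcal{A})$ is a free group of rank $|A|$. -/

import Mathlib

open Filter Topology

/-! ### The rooted tree of words, its automorphisms, and its boundary -/

/-- The group of automorphisms of the rooted tree of finite words over `A`: the bijections of the
set of words that are compatible with passing to prefixes (and hence preserve lengths). -/
def TreeAut (A : Type*) : Subgroup (Equiv.Perm (List A)) where
  carrier := {g | ∀ (w : List A) (n : ℕ), g (w.take n) = (g w).take n}
  mul_mem' := by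
    intro g h hg hh w n
    rw [Equiv.Perm.mul_apply, hh, hg, Equiv.Perm.mul_apply]
  one_mem' := fun w n => rfl
  inv_mem' := by
    intro g hg w n
    rw [Equiv.Perm.inv_eq_iff_eq, hg]
    simp

theorem TreeAut.map_take {A : Type*} (g : TreeAut A) (w : List A) (n : ℕ) :
    g.1 (w.take n) = (g.1 w).take n := g.2 w n

theorem TreeAut.length_le {A : Type*} (g : TreeAut A) (w : List A) :
    (g.1 w).length ≤ w.length := by
  have h := TreeAut.map_take g w w.length
  rw [List.take_length] at h
  rw [h]
  exact List.length_take_le _ _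

theorem TreeAut.length_eq {A : Type*} (g : TreeAut A) (w : List A) :
    (g.1 w).length = w.length := by
  apply le_antisymm (TreeAut.length_le g w)
  have h := TreeAut.length_le g⁻¹ (g.1 w)
  simpa using h

/-- Words over `A` that are infinite to the right, i.e. the boundary of the tree of words. -/
def InfWord (A : Type*) : Type _ := ℕ → A

/-- The prefix of length `n` of an infinite word. -/
def InfWord.take {A : Type*} (u : InfWord A) (n : ℕ) : List A := List.ofFn fun i : Fin n => u i

theorem InfWord.length_take {A : Type*} (u : InfWord A) (n : ℕ) : (u.take n).length = n := by
  simp [InfWord.take]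

theorem InfWord.take_take {A : Type*} (u : InfWord A) {m n : ℕ} (h : m ≤ n) :
    (u.take n).take m = u.take m := by
  apply List.ext_getElem
  · simp [InfWord.take, h]
  · intro i h1 h2
    simp [InfWord.take]

theorem InfWord.getElem_take {A : Type*} (u : InfWord A) (n i : ℕ)
    (h : i < (u.take n).length) : (u.take n)[i] = u i := by
  simp [InfWord.take]

theorem InfWord.ext_take {A : Type*} {u v : InfWord A} (h : ∀ n, u.take n = v.take n) :
    u = v := by
  funext n
  have h1 := u.getElem_take (n + 1) n (by simp [InfWord.length_take])
  have h2 := v.getElem_take (n + 1) n (by simp [InfWord.length_take])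
  rw [← h1, ← h2]
  simp only [h]

/-- Tree automorphisms act on infinite words: `g • u` is the infinite word whose prefix of
length `n` is the image under `g` of the prefix of length `n` of `u`, see `InfWord.take_smul`. -/
instance {A : Type*} : SMul (TreeAut A) (InfWord A) where
  smul g u := fun n =>
    (g.1 (u.take (n + 1)))[n]'(by rw [TreeAut.length_eq, u.length_take]; exact Nat.lt_succ_self n)

theorem InfWord.take_smul {A : Type*} (g : TreeAut A) (u : InfWord A) (n : ℕ) :
    (g • u).take n = g.1 (u.take n) := by
  apply List.ext_getElem
  · rw [TreeAut.length_eq, InfWord.length_take, InfWord.length_take]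
  · intro i h1 h2
    rw [InfWord.getElem_take]
    have hi : i + 1 ≤ n := by rw [InfWord.length_take] at h1; exact h1
    have h3 := TreeAut.map_take g (u.take n) (i + 1)
    rw [u.take_take hi] at h3
    change (g.1 (u.take (i + 1)))[i]'_ = _
    simp only [h3, List.getElem_take]

instance {A : Type*} : MulAction (TreeAut A) (InfWord A) where
  one_smul u := InfWord.ext_take fun n => by rw [InfWord.take_smul]; rfl
  mul_smul g h u := InfWord.ext_take fun n => by
    rw [InfWord.take_smul, InfWord.take_smul, InfWord.take_smul]; rfl

/-! ### Transducers -/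

/-- A transducer (Mealy automaton) with state set `Q` and input and output alphabet `A`.
There is an edge `q --a|b--> p` when `next q a = p` and `out q a = b`. -/
structure Transducer (Q A : Type*) where
  next : Q → A → Q
  out : Q → A → A

namespace Transducer

variable {Q A : Type*}

/-- The transformation of finite words defined by a state. -/
def act (M : Transducer Q A) : Q → List A → List A
  | _, [] => []
  | q, a :: w => M.out q a :: M.act (M.next q a) w

/-- Every state permutes the alphabet. -/
def Invertible (M : Transducer Q A) : Prop := ∀ q, Function.Bijective (M.out q)

/-- In the input automaton, every letter permutes the states. -/
def Reversible (M : Transducer Q A) : Prop := ∀ a, Function.Bijective fun q => M.next q a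

/-- The input automaton and the output automaton (with an edge `q --b--> p` for every edge
`q --a|b--> p`) are both reversible semiautomata. The field `invertible` says that the output
automaton is complete and deterministic, the field `out_reversible` that each letter permutes the
states in it: every state `p` has exactly one incoming edge with output label `b`. -/
structure Bireversible (M : Transducer Q A) : Prop where
  reversible : M.Reversible
  invertible : M.Invertible
  out_reversible : ∀ (b : A) (p : Q), ∃! e : Q × A, M.next e.1 e.2 = p ∧ M.out e.1 e.2 = b

/-- The dual transducer: `a --p|q--> b` whenever `p --a|b--> q`. -/
def dual (M : Transducer Q A) : Transducer A Q where
  next a q := M.out q a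
  out a q := M.next q a

/-- The dual of a bireversible transducer is invertible. -/
theorem Bireversible.dual_invertible {M : Transducer Q A} (h : M.Bireversible) :
    M.dual.Invertible := h.reversible

theorem act_take (M : Transducer Q A) (q : Q) (w : List A) (n : ℕ) :
    M.act q (w.take n) = (M.act q w).take n := by
  induction w generalizing q n with
  | nil => simp [act]
  | cons a w ih => cases n with
    | zero => simp [act]
    | succ n => simp [act, ih]

/-- The inverse transducer: `q --a|b--> p` whenever `q --b|a--> p` in `M`. -/
noncomputable def inverse (M : Transducer Q A) (h : M.Invertible) : Transducer Q A where
  next q b := M.next q ((Equiv.ofBijective _ (h q)).symm b)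
  out q b := (Equiv.ofBijective _ (h q)).symm b

theorem inverse_out_out (M : Transducer Q A) (h : M.Invertible) (q : Q) (a : A) :
    (M.inverse h).out q (M.out q a) = a :=
  (Equiv.ofBijective _ (h q)).symm_apply_apply a

theorem out_inverse_out (M : Transducer Q A) (h : M.Invertible) (q : Q) (b : A) :
    M.out q ((M.inverse h).out q b) = b :=
  (Equiv.ofBijective _ (h q)).apply_symm_apply b

theorem inverse_act_act (M : Transducer Q A) (h : M.Invertible) (q : Q) (w : List A) :
    (M.inverse h).act q (M.act q w) = w := by
  induction w generalizing q with
  | nil => rfl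
  | cons a w ih =>
    have h1 : (M.inverse h).next q (M.out q a) = M.next q a := by
      change M.next q ((M.inverse h).out q (M.out q a)) = _
      rw [inverse_out_out]
    simp [act, h1, inverse_out_out, ih]

theorem act_inverse_act (M : Transducer Q A) (h : M.Invertible) (q : Q) (w : List A) :
    M.act q ((M.inverse h).act q w) = w := by
  induction w generalizing q with
  | nil => rfl
  | cons a w ih =>
    simp only [act, out_inverse_out]
    exact congrArg _ (ih _)

/-- The tree automorphism defined by a state of an invertible transducer. -/
noncomputable def stateAut (M : Transducer Q A) (h : M.Invertible) (q : Q) : TreeAut A :=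
  ⟨⟨M.act q, (M.inverse h).act q, M.inverse_act_act h q, M.act_inverse_act h q⟩,
    fun w n => M.act_take q w n⟩

/-- The group generated by an invertible transducer. -/
noncomputable def group (M : Transducer Q A) (h : M.Invertible) : Subgroup (TreeAut A) :=
  Subgroup.closure (Set.range (M.stateAut h))

/-! ### The enriched transducer

The letter `(a, true)` of the alphabet `A × Bool` stands for `a` and `(a, false)` for the formal
inverse of `a`, as in `FreeGroup A`. -/

/-- The enriched transducer over the involutive alphabet: it has the edges `q --a|b--> p` of `M`
and for each of them the edge `p --a⁻¹|b⁻¹--> q`. -/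
noncomputable def enrich (M : Transducer Q A) (h : M.Reversible) : Transducer Q (A × Bool) where
  next p x := match x with
    | (a, true) => M.next p a
    | (a, false) => (Equiv.ofBijective _ (h a)).symm p
  out p x := match x with
    | (a, true) => (M.out p a, true)
    | (a, false) => (M.out ((Equiv.ofBijective _ (h a)).symm p) a, false)

/-- The formal inverse of a letter. -/
def invLetter (x : A × Bool) : A × Bool := (x.1, !x.2)

theorem enrich_next_inv (M : Transducer Q A) (h : M.Reversible) (p : Q) (x : A × Bool) :
    (M.enrich h).next ((M.enrich h).next p x) (invLetter x) = p := by
  obtain ⟨a, _ | _⟩ := x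
  · exact (Equiv.ofBijective _ (h a)).apply_symm_apply p
  · exact (Equiv.ofBijective _ (h a)).symm_apply_apply p

theorem enrich_out_inv (M : Transducer Q A) (h : M.Reversible) (p : Q) (x : A × Bool) :
    (M.enrich h).out ((M.enrich h).next p x) (invLetter x)
      = invLetter ((M.enrich h).out p x) := by
  obtain ⟨a, _ | _⟩ := x
  · rfl
  · have h1 : (Equiv.ofBijective _ (h a)).symm (M.next p a) = p :=
      (Equiv.ofBijective _ (h a)).symm_apply_apply p
    simp [enrich, invLetter, h1]

/-- The enriched transducer of a bireversible transducer is invertible. -/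
theorem Bireversible.enrich_invertible {M : Transducer Q A} (h : M.Bireversible) :
    (M.enrich h.reversible).Invertible := by
  intro p
  constructor
  · rintro ⟨a, _ | _⟩ ⟨b, _ | _⟩ hab
    · have h1 : M.out ((Equiv.ofBijective _ (h.reversible a)).symm p) a
          = M.out ((Equiv.ofBijective _ (h.reversible b)).symm p) b := congrArg Prod.fst hab
      have ha := (Equiv.ofBijective _ (h.reversible a)).apply_symm_apply p
      have hb := (Equiv.ofBijective _ (h.reversible b)).apply_symm_apply p
      have h2 := (h.out_reversible _ p).unique (y₁ := (_, a)) (y₂ := (_, b)) ⟨ha, h1⟩ ⟨hb, rfl⟩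
      have h3 : a = b := congrArg Prod.snd h2
      rw [h3]
    · have h2 : false = true := congrArg Prod.snd hab
      cases h2
    · have h2 : true = false := congrArg Prod.snd hab
      cases h2
    · have h1 : M.out p a = M.out p b := congrArg Prod.fst hab
      rw [(h.invertible p).1 h1]
  · rintro ⟨b, _ | _⟩
    · obtain ⟨⟨q, a⟩, ⟨h1, h2⟩, -⟩ := h.out_reversible b p
      refine ⟨(a, false), ?_⟩
      have h3 : (Equiv.ofBijective _ (h.reversible a)).symm p = q := by
        rw [Equiv.symm_apply_eq]; exact h1.symm
      simp only [enrich, h3]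
      exact congrArg (fun c => (c, false)) h2
    · obtain ⟨a, ha⟩ := (h.invertible p).2 b
      exact ⟨(a, true), congrArg (fun c => (c, true)) ha⟩

/-! ### The group of the enriched transducer

The groups generated by a bireversible transducer and by its enriched transducer are canonically
isomorphic. This is what makes the former group act on the infinite words over the involutive
alphabet. -/

/-- The disjoint union of an invertible transducer and its inverse. -/
noncomputable def signed (M : Transducer Q A) (h : M.Invertible) : Transducer (Q × Bool) A where
  next s a := match s with
    | (q, true) => (M.next q a, true)
    | (q, false) => ((M.inverse h).next q a, false)
  out s a := match s with
    | (q, true) => M.out q a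
    | (q, false) => (M.inverse h).out q a

/-- The word of states reached from a word of states reading a letter (the last state reads it
first), together with the letter that is output. -/
def wordNext (M : Transducer Q A) : List Q → A → List Q × A
  | [], a => ([], a)
  | q :: ws, a => (M.next q (M.wordNext ws a).2 :: (M.wordNext ws a).1, M.out q (M.wordNext ws a).2)

/-- The composition of the transformations defined by a word of states. -/
def wordAct (M : Transducer Q A) (ws : List Q) (v : List A) : List A := ws.foldr M.act v

theorem wordAct_nil (M : Transducer Q A) (ws : List Q) : M.wordAct ws [] = [] := by
  induction ws with
  | nil => rfl
  | cons q ws ih =>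
    change M.act q (M.wordAct ws []) = []
    rw [ih]; rfl

theorem wordAct_cons (M : Transducer Q A) (ws : List Q) (a : A) (v : List A) :
    M.wordAct ws (a :: v) = (M.wordNext ws a).2 :: M.wordAct (M.wordNext ws a).1 v := by
  induction ws with
  | nil => rfl
  | cons q ws ih =>
    change M.act q (M.wordAct ws (a :: v)) = _
    rw [ih]; rfl

theorem length_wordNext (M : Transducer Q A) (ws : List Q) (a : A) :
    (M.wordNext ws a).1.length = ws.length := by
  induction ws with
  | nil => rfl
  | cons q ws ih => simp [wordNext, ih]

/-- The signed enriched transducer is closed under inverting both labels and reversing edges. -/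
theorem signed_enrich_inv {M : Transducer Q A} (h : M.Bireversible) (s : Q × Bool)
    (x : A × Bool) :
    let S := (M.enrich h.reversible).signed h.enrich_invertible
    S.next (S.next s x) (invLetter x) = s ∧
      S.out (S.next s x) (invLetter x) = invLetter (S.out s x) := by
  intro S
  obtain ⟨q, _ | _⟩ := s
  · set E := M.enrich h.reversible with hE
    set y := (E.inverse h.enrich_invertible).out q x with hy
    have hx : E.out q y = x := E.out_inverse_out h.enrich_invertible q x
    have h1 := M.enrich_next_inv h.reversible q y
    have h2 := M.enrich_out_inv h.reversible q y
    rw [← hE, hx] at h2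
    rw [← hE] at h1
    have h3 : (E.inverse h.enrich_invertible).out (E.next q y) (invLetter x) = invLetter y := by
      rw [← h2, E.inverse_out_out]
    refine ⟨?_, h3⟩
    change (E.next (E.next q y)
      ((E.inverse h.enrich_invertible).out (E.next q y) (invLetter x)), false) = _
    rw [h3, h1]
  · exact ⟨congrArg (fun p => (p, true)) (M.enrich_next_inv h.reversible q x),
      M.enrich_out_inv h.reversible q x⟩

theorem wordNext_inv {M : Transducer Q A} (h : M.Bireversible) (ws : List (Q × Bool))
    (x : A × Bool) :
    let S := (M.enrich h.reversible).signed h.enrich_invertible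
    S.wordNext (S.wordNext ws x).1 (invLetter x) = (ws, invLetter (S.wordNext ws x).2) := by
  intro S
  induction ws with
  | nil => rfl
  | cons s ws ih =>
    have h1 := signed_enrich_inv h s (S.wordNext ws x).2
    simp only [wordNext, ih]
    rw [h1.1, h1.2]

/-- A word of states acting trivially on the positive words acts trivially on all words. -/
theorem wordAct_eq_of_positive [Finite Q] {M : Transducer Q A} (h : M.Bireversible)
    (ws : List (Q × Bool)) :
    let S := (M.enrich h.reversible).signed h.enrich_invertible
    (∀ v : List A, S.wordAct ws (v.map fun a => (a, true)) = v.map fun a => (a, true)) →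
      ∀ v, S.wordAct ws v = v := by
  intro S hws v
  let P : Set (List (Q × Bool)) := {ts | ts.length = ws.length ∧
    ∀ v : List A, S.wordAct ts (v.map fun a => (a, true)) = v.map fun a => (a, true)}
  have hfin : P.Finite := (List.finite_length_eq (Q × Bool) ws.length).subset fun ts h => h.1
  have hP : ∀ ts ∈ P, ∀ a : A,
      (S.wordNext ts (a, true)).1 ∈ P ∧ (S.wordNext ts (a, true)).2 = (a, true) := by
    intro ts hts a
    have key : ∀ v : List A, _ := fun v => hts.2 (a :: v)
    simp only [List.map_cons, wordAct_cons, List.cons.injEq] at key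
    exact ⟨⟨(S.length_wordNext ts _).trans hts.1, fun v => (key v).2⟩, (key []).1⟩
  have hP' : ∀ ts ∈ P, ∀ x : A × Bool, (S.wordNext ts x).1 ∈ P ∧ (S.wordNext ts x).2 = x := by
    rintro ts hts ⟨a, _ | _⟩
    · have hinj : Set.InjOn (fun ts => (S.wordNext ts (a, true)).1) P := by
        intro t1 _ t2 _ h12
        have e1 := congrArg Prod.fst (wordNext_inv h t1 (a, true))
        have e2 := congrArg Prod.fst (wordNext_inv h t2 (a, true))
        simp only at h12 e1 e2
        rw [← e1, ← e2]
        exact congrArg (fun t => (S.wordNext t (invLetter (a, true))).1) h12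
      have hsurj : Set.SurjOn (fun ts => (S.wordNext ts (a, true)).1) P P :=
        ((hfin.injOn_iff_bijOn_of_mapsTo fun ts hts => (hP ts hts a).1).1 hinj).surjOn
      obtain ⟨t, ht, rfl⟩ := hsurj hts
      have e : S.wordNext (S.wordNext t (a, true)).1 (a, false) =
          (t, invLetter (S.wordNext t (a, true)).2) := wordNext_inv h t (a, true)
      rw [(hP t ht a).2] at e
      simp only [e]
      exact ⟨ht, rfl⟩
    · exact hP ts hts a
  have main : ∀ v, ∀ ts ∈ P, S.wordAct ts v = v := by
    intro v
    induction v with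
    | nil => intro ts _; exact S.wordAct_nil ts
    | cons x v ih =>
      intro ts hts
      rw [wordAct_cons, ih _ (hP' ts hts x).1, (hP' ts hts x).2]
  exact main v ws ⟨rfl, hws⟩

/-- The homomorphism from the free group on the states onto the generated group. -/
noncomputable def freeHom (M : Transducer Q A) (h : M.Invertible) : FreeGroup Q →* TreeAut A :=
  FreeGroup.lift (M.stateAut h)

theorem freeHom_mk (M : Transducer Q A) (h : M.Invertible) (ws : List (Q × Bool)) (v : List A) :
    (M.freeHom h (FreeGroup.mk ws)).1 v = (M.signed h).wordAct ws v := by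
  induction ws with
  | nil => rfl
  | cons s ws ih =>
    have h1 : FreeGroup.mk (s :: ws) = FreeGroup.mk [s] * FreeGroup.mk ws := by
      rw [FreeGroup.mul_mk]; rfl
    rw [h1, map_mul]
    change (M.freeHom h (FreeGroup.mk [s])).1 ((M.freeHom h (FreeGroup.mk ws)).1 v) =
      (M.signed h).act s ((M.signed h).wordAct ws v)
    rw [ih]
    generalize (M.signed h).wordAct ws v = w
    obtain ⟨q, _ | _⟩ := s
    · have h2 : M.freeHom h (FreeGroup.mk [(q, false)]) = (M.stateAut h q)⁻¹ := by
        simp [freeHom]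
      rw [h2]
      change (M.inverse h).act q w = _
      clear ih h1 h2
      induction w generalizing q with
      | nil => rfl
      | cons a w ihw => exact congrArg _ (ihw _)
    · have h2 : M.freeHom h (FreeGroup.mk [(q, true)]) = M.stateAut h q := by
        simp [freeHom]
      rw [h2]
      change M.act q w = _
      clear ih h1 h2
      induction w generalizing q with
      | nil => rfl
      | cons a w ihw => exact congrArg _ (ihw _)

/-- On positive words the enriched transducer acts as the original one. -/
theorem freeHom_enrich_positive {M : Transducer Q A} (h : M.Bireversible) (x : FreeGroup Q)
    (v : List A) :
    ((M.enrich h.reversible).freeHom h.enrich_invertible x).1 (v.map fun a => (a, true)) =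
      ((M.freeHom h.invertible x).1 v).map fun a => (a, true) := by
  have hpos : ∀ (q : Q) (v : List A), (M.enrich h.reversible).act q (v.map fun a => (a, true)) =
      (M.act q v).map fun a => (a, true) := by
    intro q v
    induction v generalizing q with
    | nil => rfl
    | cons a v ih => exact congrArg _ (ih _)
  induction x using FreeGroup.induction_on generalizing v with
  | C1 => simp
  | of q =>
    simp only [freeHom, FreeGroup.lift_apply_of]
    exact hpos q v
  | inv_of q _ =>
    rw [map_inv, map_inv]
    change ((M.enrich h.reversible).freeHom h.enrich_invertible (FreeGroup.of q)).1⁻¹ _ = _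
    rw [Equiv.Perm.inv_eq_iff_eq]
    simp only [freeHom, FreeGroup.lift_apply_of]
    refine Eq.trans ?_ (hpos q _).symm
    exact congrArg _ (M.act_inverse_act h.invertible q v).symm
  | mul x y hx hy =>
    rw [map_mul, map_mul]
    change ((M.enrich h.reversible).freeHom h.enrich_invertible x).1
      (((M.enrich h.reversible).freeHom h.enrich_invertible y).1 _) = _
    rw [hy, hx]
    rfl

theorem ker_freeHom_enrich [Finite Q] {M : Transducer Q A} (h : M.Bireversible) :
    (M.freeHom h.invertible).ker =
      ((M.enrich h.reversible).freeHom h.enrich_invertible).ker := by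
  ext x
  rw [MonoidHom.mem_ker, MonoidHom.mem_ker]
  constructor
  · intro hx
    apply Subtype.ext
    apply Equiv.ext
    intro v
    obtain ⟨ws, rfl⟩ := Quot.exists_rep x
    change ((M.enrich h.reversible).freeHom h.enrich_invertible (FreeGroup.mk ws)).1 v = v
    rw [freeHom_mk]
    refine wordAct_eq_of_positive h ws (fun v => ?_) v
    rw [← freeHom_mk, freeHom_enrich_positive h]
    change M.freeHom h.invertible (FreeGroup.mk ws) = 1 at hx
    rw [hx]
    rfl
  · intro hx
    apply Subtype.ext
    apply Equiv.ext
    intro v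
    have h1 := freeHom_enrich_positive h x v
    rw [hx] at h1
    have hinj : Function.Injective fun a : A => (a, true) := fun a b hab => congrArg Prod.fst hab
    exact (hinj.list_map h1).symm

theorem range_freeHom (M : Transducer Q A) (h : M.Invertible) :
    (M.freeHom h).range = M.group h := FreeGroup.range_lift_eq_closure

/-- The canonical isomorphism from the group generated by a bireversible transducer onto the group
generated by its enriched transducer, see `enrichEquiv_stateAut`. -/
noncomputable def enrichEquiv [Finite Q] {M : Transducer Q A} (h : M.Bireversible) :
    M.group h.invertible ≃* (M.enrich h.reversible).group h.enrich_invertible :=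
  (MulEquiv.subgroupCongr (M.range_freeHom h.invertible)).symm.trans <|
    (QuotientGroup.quotientKerEquivRange (M.freeHom h.invertible)).symm.trans <|
    (QuotientGroup.quotientMulEquivOfEq (ker_freeHom_enrich h)).trans <|
    (QuotientGroup.quotientKerEquivRange
      ((M.enrich h.reversible).freeHom h.enrich_invertible)).trans <|
    MulEquiv.subgroupCongr ((M.enrich h.reversible).range_freeHom h.enrich_invertible)

theorem stateAut_mem_group (M : Transducer Q A) (h : M.Invertible) (q : Q) :
    M.stateAut h q ∈ M.group h := Subgroup.subset_closure ⟨q, rfl⟩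

theorem enrichEquiv_stateAut [Finite Q] {M : Transducer Q A} (h : M.Bireversible) (q : Q) :
    enrichEquiv h ⟨M.stateAut h.invertible q, M.stateAut_mem_group h.invertible q⟩ =
      ⟨(M.enrich h.reversible).stateAut h.enrich_invertible q,
        (M.enrich h.reversible).stateAut_mem_group h.enrich_invertible q⟩ := by
  have h1 : (⟨M.stateAut h.invertible q, M.stateAut_mem_group h.invertible q⟩ :
      M.group h.invertible) = MulEquiv.subgroupCongr (M.range_freeHom h.invertible)
        (QuotientGroup.quotientKerEquivRange (M.freeHom h.invertible)
          (QuotientGroup.mk (FreeGroup.of q))) := by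
    apply Subtype.ext
    change M.stateAut h.invertible q = M.freeHom h.invertible (FreeGroup.of q)
    simp [freeHom]
  rw [h1]
  simp only [enrichEquiv, MulEquiv.trans_apply, MulEquiv.symm_apply_apply]
  apply Subtype.ext
  change (M.enrich h.reversible).freeHom h.enrich_invertible (FreeGroup.of q) = _
  simp [freeHom]

/-- The stabilizer, in the group generated by a bireversible transducer, of an infinite word over
the involutive alphabet. -/
noncomputable def stabilizer [Finite Q] {M : Transducer Q A} (h : M.Bireversible)
    (u : InfWord (A × Bool)) : Subgroup (M.group h.invertible) :=
  (MulAction.stabilizer ((M.enrich h.reversible).group h.enrich_invertible) u).comap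
    (enrichEquiv h).toMonoidHom

end Transducer

/-! ### The completion of the free group and essentially non-trivial words -/

/-- The completion of the free group on `A`: the finite or infinite reduced words over the
involutive alphabet. A word is given by its sequence of letters, a finite one being continued by
the value `none`. -/
def FreeCompletion (A : Type*) : Type _ :=
  {s : ℕ → Option (A × Bool) // (∀ n, s n = none → s (n + 1) = none) ∧
    ∀ n a b, s n = some a → s (n + 1) = some b → a.1 = b.1 → a.2 = b.2}

open Classical in
/-- The element of the completion given by the reduced form of an element of the free group. -/
noncomputable def FreeCompletion.ofFree {A : Type*} (x : FreeGroup A) : FreeCompletion A :=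
  ⟨fun n => x.toWord[n]?, by
    intro n hn
    rw [List.getElem?_eq_none_iff] at hn ⊢
    omega, by
    intro n a b ha hb
    obtain ⟨ha1, ha2⟩ := List.getElem?_eq_some_iff.1 ha
    obtain ⟨hb1, hb2⟩ := List.getElem?_eq_some_iff.1 hb
    have h := List.isChain_iff_getElem.1 (FreeGroup.isReduced_toWord (x := x)) n hb1
    rw [ha2, hb2] at h
    exact h⟩

open Classical in
/-- The distance `2 ^ (-|ξ ∧ η|)` of distinct elements `ξ`, `η` with longest common prefix
`ξ ∧ η`; its length is the first index at which the sequences differ. -/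
noncomputable def FreeCompletion.dist {A : Type*} (ξ η : FreeCompletion A) : ℝ :=
  if ξ = η then 0 else (1 / 2 : ℝ) ^ PiNat.firstDiff ξ.1 η.1

/-- An infinite word over the involutive alphabet is essentially non-trivial if a subsequence of
the reduced forms of its finite prefixes converges, in the completion of the free group, to an
element that is not in the free group. -/
def EssentiallyNontrivial {A : Type*} (u : InfWord (A × Bool)) : Prop :=
  ∃ φ : ℕ → ℕ, StrictMono φ ∧ ∃ ξ : FreeCompletion A,
    ξ ∉ Set.range (FreeCompletion.ofFree (A := A)) ∧
      Tendsto (fun j => (FreeCompletion.ofFree (FreeGroup.mk (u.take (φ j)))).dist ξ)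
        atTop (𝓝 0)

/-! Suppose the natural map from the free group on `A` to the dual group has a nontrivial kernel.
The kernel is normal, so it contains a nonempty cyclically reduced word; read in the order in which
its letters act, call it `w`. By duality, triviality of `w` on words of states means that the
enriched transducer, reading `w` from any state `q`, returns to `q`, and that the output is again
such a word (`trivialWords_run`). Hence every `g` in the enriched group satisfies g(wv) = g(w)g(v):
its section at `w` is `g` itself (`group_act_trivialWords`).

An infinite group has a nontrivial element fixing `w`, because the orbit of `w` lies in a finite
level (`exists_ne_one_fixing`). This element then fixes www⋯. As `w` is cyclically reduced, www⋯ is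
reduced, hence essentially non-trivial, and its stabilizer should have been trivial. -/

/-! ### Periodic infinite words -/

/-- The infinite word `w w w ⋯`. -/
def InfWord.periodic {B : Type*} (w : List B) (hw : w ≠ []) : InfWord B :=
  fun n => w[n % w.length]'(Nat.mod_lt _ (List.length_pos_iff.2 hw))

theorem InfWord.periodic_take_add {B : Type*} (w : List B) (hw : w ≠ []) (n : ℕ) :
    (InfWord.periodic w hw).take (w.length + n) = w ++ (InfWord.periodic w hw).take n := by
  apply List.ext_getElem
  · simp [InfWord.length_take]
  · intro i h1 h2
    rw [InfWord.getElem_take, List.getElem_append]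
    split_ifs with h
    · simp only [InfWord.periodic, Nat.mod_eq_of_lt h]
    · rw [InfWord.getElem_take]
      simp only [InfWord.periodic, Nat.mod_eq_sub_mod (not_lt.1 h)]

theorem InfWord.periodic_take_mul {B : Type*} (w : List B) (hw : w ≠ []) (n : ℕ) :
    (InfWord.periodic w hw).take (n * w.length) = (List.replicate n w).flatten := by
  induction n with
  | zero => simp [InfWord.take]
  | succ n ih =>
    rw [Nat.succ_mul, add_comm, InfWord.periodic_take_add, ih, List.replicate_succ,
      List.flatten_cons]

theorem InfWord.le_mul_length {B : Type*} {w : List B} (hw : w ≠ []) (n : ℕ) :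
    n ≤ n * w.length :=
  Nat.le_mul_of_pos_right n (List.length_pos_iff.2 hw)

/-- With v = [] the hypothesis says that `g` fixes `w`; for general v, that `g` reappears below `w`.
So `g` fixes all powers of `w`, and every prefix of the periodic word is a prefix of a power. -/
theorem TreeAut.smul_periodic {B : Type*} (g : TreeAut B) (w : List B) (hw : w ≠ [])
    (hg : ∀ v, g.1 (w ++ v) = w ++ g.1 v) :
    g • InfWord.periodic w hw = InfWord.periodic w hw := by
  have hfix : ∀ n, g.1 ((InfWord.periodic w hw).take (n * w.length)) =
      (InfWord.periodic w hw).take (n * w.length) := by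
    intro n
    induction n with
    | zero =>
      rw [Nat.zero_mul, List.eq_nil_of_length_eq_zero (InfWord.length_take _ 0)]
      exact List.eq_nil_of_length_eq_zero (TreeAut.length_eq g [])
    | succ n ih => rw [Nat.succ_mul, add_comm, InfWord.periodic_take_add, hg, ih]
  apply InfWord.ext_take
  intro n
  rw [InfWord.take_smul, ← InfWord.take_take _ (InfWord.le_mul_length hw n), TreeAut.map_take,
    hfix]

/-! ### Reduced infinite words are essentially non-trivial -/

/-- Each prefix is its own reduced form, so the whole sequence of prefixes converges to `u`, which
is infinite and thus outside the free group. -/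
theorem essentiallyNontrivial_of_isReduced {A : Type*} (u : InfWord (A × Bool))
    (hu : ∀ n, FreeGroup.IsReduced (u.take n)) : EssentiallyNontrivial u := by
  classical
  have hcons : ∀ n, (u n).1 = (u (n + 1)).1 → (u n).2 = (u (n + 1)).2 := by
    intro n
    have h := List.isChain_iff_getElem.1 (hu (n + 2)) n (by rw [InfWord.length_take]; omega)
    simpa only [InfWord.getElem_take] using h
  let ξ : FreeCompletion A := ⟨fun n => some (u n), by simp, by
    intro n a b ha hb
    rw [Option.some.injEq] at ha hb
    subst ha hb
    exact hcons n⟩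
  have hval : ∀ n i, (FreeCompletion.ofFree (FreeGroup.mk (u.take n))).1 i = (u.take n)[i]? := by
    intro n i
    simp only [FreeCompletion.ofFree, FreeGroup.toWord_mk]
    rw [(hu n).reduce_eq]
  refine ⟨id, strictMono_id, ξ, ?_, ?_⟩
  · rintro ⟨x, hx⟩
    -- At this index the finite word `x` has ended, while `ξ` never takes the value `none`.
    have h := congrFun (congrArg Subtype.val hx) x.toWord.length
    simp only [FreeCompletion.ofFree, ξ] at h
    rw [List.getElem?_eq_some_iff] at h
    obtain ⟨h, -⟩ := h
    -- The two reduced forms of `x` may be computed with different decidability instances.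
    have : (@FreeGroup.toWord A (fun a b => Classical.propDecidable _) x).length ≤
      x.toWord.length := by
      convert le_rfl
    omega
  · have hlim : Tendsto (fun n : ℕ => (1 / 2 : ℝ) ^ n) atTop (𝓝 0) :=
      tendsto_pow_atTop_nhds_zero_of_lt_one (by norm_num) (by norm_num)
    refine squeeze_zero (fun n => ?_) (fun n => ?_) hlim
    · unfold FreeCompletion.dist
      split_ifs <;> positivity
    · unfold FreeCompletion.dist
      split_ifs with h
      · positivity
      · refine pow_le_pow_of_le_one (by norm_num) (by norm_num) ?_
        -- A first difference at an index below `n` is impossible: there the prefix of length `n`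
        -- agrees with `u`.
        by_contra! hlt
        have hne := PiNat.apply_firstDiff_ne (fun h' => h (Subtype.ext h'))
        apply hne
        dsimp only [id] at hlt ⊢
        rw [hval, List.getElem?_eq_getElem (by rw [InfWord.length_take]; exact hlt),
          InfWord.getElem_take]

/-! ### Cyclically reduced words, their powers, and kernels of homomorphisms -/

namespace FreeGroup

/-- The condition on neighbouring letters is symmetric. Reversal translates between products, where
the last letter acts first, and words read from the left. -/
theorem IsCyclicallyReduced.reverse {α : Type*} {L : List (α × Bool)}
    (h : IsCyclicallyReduced L) : IsCyclicallyReduced L.reverse := by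
  refine ⟨?_, fun a ha b hb hab => ?_⟩
  · rw [IsReduced, List.isChain_reverse]
    exact h.1.imp fun a b hab hba => (hab hba.symm).symm
  · rw [List.getLast?_reverse] at ha
    rw [List.head?_reverse] at hb
    exact (h.2 b hb a ha hab.symm).symm

theorem IsCyclicallyReduced.isReduced_periodic {α : Type*} {L : List (α × Bool)}
    (h : IsCyclicallyReduced L) (hL : L ≠ []) (n : ℕ) :
    IsReduced ((InfWord.periodic L hL).take n) := by
  rw [← InfWord.take_take _ (InfWord.le_mul_length hL n), InfWord.periodic_take_mul]
  exact (h.flatten_replicate n).isReduced.infix (List.take_prefix _ _).isInfix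

/-- A nontrivial kernel element is conjugate to its cyclic reduction, which stays in the kernel and
is nonempty, since otherwise the element would be 1. -/
theorem exists_isCyclicallyReduced_of_not_injective {α H : Type*} [Group H]
    (f : FreeGroup α →* H) (hf : ¬ Function.Injective f) :
    ∃ L : List (α × Bool), L ≠ [] ∧ IsCyclicallyReduced L ∧ f (mk L) = 1 := by
  classical
  rw [injective_iff_map_eq_one] at hf
  push Not at hf
  obtain ⟨x, hx, hx1⟩ := hf
  have hconj := reduceCyclically.conj_conjugator_reduceCyclically x.toWord
  have hx' : x = mk (reduceCyclically.conjugator x.toWord) * mk (reduceCyclically x.toWord) *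
      (mk (reduceCyclically.conjugator x.toWord))⁻¹ := by
    rw [inv_mk, mul_mk, mul_mk, hconj, mk_toWord]
  refine ⟨reduceCyclically x.toWord, fun h => ?_,
    reduceCyclically.isCyclicallyReduced isReduced_toWord, ?_⟩
  · rw [h, ← one_eq_mk, mul_one, mul_inv_cancel] at hx'
    exact hx1 hx'
  · rw [hx', _root_.map_mul, _root_.map_mul, _root_.map_inv, mul_inv_eq_one] at hx
    exact mul_eq_left.1 hx

end FreeGroup

/-! ### Relators of the dual group act as the identity on the states -/

namespace Transducer

variable {Q A : Type*}

/-- The state reached from `q` after reading a word. -/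
def run (M : Transducer Q A) (q : Q) (w : List A) : Q := w.foldl M.next q

theorem act_append (M : Transducer Q A) (q : Q) (w v : List A) :
    M.act q (w ++ v) = M.act q w ++ M.act (M.run q w) v := by
  induction w generalizing q with
  | nil => rfl
  | cons a w ih => exact congrArg _ (ih _)

theorem wordNext_append (M : Transducer Q A) (ws ts : List Q) (a : A) :
    M.wordNext (ws ++ ts) a = ((M.wordNext ws (M.wordNext ts a).2).1 ++ (M.wordNext ts a).1,
      (M.wordNext ws (M.wordNext ts a).2).2) := by
  induction ws with
  | nil => rfl
  | cons q ws ih => simp [wordNext, ih]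

/-- This is the duality between the two actions: a word passing through a state is the same
computation as the state passing through the word. The reversal is needed because in `wordNext` the
last entry reads first. -/
theorem wordNext_dual_reverse {M : Transducer Q A} (h : M.Bireversible) (w : List (A × Bool))
    (q : Q) :
    (M.dual.signed h.dual_invertible).wordNext w.reverse q =
      (((M.enrich h.reversible).act q w).reverse, (M.enrich h.reversible).run q w) := by
  induction w generalizing q with
  | nil => rfl
  | cons x w ih =>
    have h1 : (M.dual.signed h.dual_invertible).wordNext [x] q =
        ([(M.enrich h.reversible).out q x], (M.enrich h.reversible).next q x) := by
      -- For an inverse letter, both sides use the inverse of the same permutation `q ↦ M.next q a`.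
      obtain ⟨a, _ | _⟩ := x <;> rfl
    rw [List.reverse_cons, wordNext_append, h1, ih]
    simp [act, run]

/-- The words over the involutive alphabet that act trivially on the words of states; they are
written so that the first letter acts first. -/
def trivialWords {M : Transducer Q A} (h : M.Bireversible) : Set (List (A × Bool)) :=
  {w | ∀ v, (M.dual.signed h.dual_invertible).wordAct w.reverse v = v}

/-- Apply triviality to `q :: v`: the first letter of the image is the state reached, and the tail
is the action of the output word on `v`. -/
theorem trivialWords_run {M : Transducer Q A} (h : M.Bireversible) {w : List (A × Bool)}
    (hw : w ∈ trivialWords h) (q : Q) :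
    (M.enrich h.reversible).run q w = q ∧ (M.enrich h.reversible).act q w ∈ trivialWords h := by
  have key : ∀ v : List Q, _ := fun v => hw (q :: v)
  simp only [wordAct_cons, List.cons.injEq] at key
  have e := wordNext_dual_reverse h w q
  refine ⟨?_, fun v => ?_⟩
  · exact (congrArg Prod.snd e).symm.trans (key []).1
  · have hv := (key v).2
    rwa [e] at hv

theorem group_act_trivialWords [Finite A] {M : Transducer Q A} (h : M.Bireversible)
    {g : TreeAut (A × Bool)} (hg : g ∈ (M.enrich h.reversible).group h.enrich_invertible) :
    ∀ w ∈ trivialWords h, g.1 w ∈ trivialWords h ∧ ∀ v, g.1 (w ++ v) = g.1 w ++ g.1 v := by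
  induction hg using Subgroup.closure_induction with
  | mem g hg =>
    obtain ⟨q, rfl⟩ := hg
    intro w hw
    obtain ⟨h1, h2⟩ := trivialWords_run h hw q
    refine ⟨h2, fun v => ?_⟩
    change (M.enrich h.reversible).act q (w ++ v) = _
    rw [act_append, h1]
    rfl
  | one => exact fun w hw => ⟨hw, fun v => rfl⟩
  | mul g k _ _ hg hk =>
    intro w hw
    obtain ⟨h1, h2⟩ := hk w hw
    obtain ⟨h3, h4⟩ := hg _ h1
    refine ⟨h3, fun v => ?_⟩
    change g.1 (k.1 (w ++ v)) = g.1 (k.1 w) ++ g.1 (k.1 v)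
    rw [h2, h4]
  | inv g _ hg =>
    intro w hw
    -- `g` maps this finite set injectively into itself, hence onto, so the preimage of `w` is again
    -- a trivial word.
    let P : Set (List (A × Bool)) := {v | v.length = w.length ∧ v ∈ trivialWords h}
    have hfin : P.Finite :=
      (List.finite_length_eq (A × Bool) w.length).subset fun v hv => hv.1
    have hmaps : Set.MapsTo g.1 P P := fun v hv =>
      ⟨(TreeAut.length_eq g v).trans hv.1, (hg v hv.2).1⟩
    have hsurj : Set.SurjOn g.1 P P :=
      ((hfin.injOn_iff_bijOn_of_mapsTo hmaps).1 g.1.injective.injOn).surjOn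
    obtain ⟨t, ht, rfl⟩ := hsurj ⟨rfl, hw⟩
    have hinv : (g⁻¹).1 (g.1 t) = t := Equiv.symm_apply_apply _ _
    rw [hinv]
    refine ⟨ht.2, fun v => ?_⟩
    change g.1⁻¹ _ = _
    rw [Equiv.Perm.inv_eq_iff_eq, (hg t ht.2).2]
    exact congrArg _ (Equiv.apply_symm_apply g.1 v).symm

/-- In an infinite group of automorphisms of a tree of finite degree every vertex is fixed by a
nontrivial element. -/
theorem exists_ne_one_fixing {B : Type*} [Finite B] (G : Subgroup (TreeAut B)) [Infinite G]
    (w : List B) : ∃ g ∈ G, g ≠ 1 ∧ g.1 w = w := by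
  have : Finite {v : List B // v.length = w.length} :=
    (List.finite_length_eq B w.length).to_subtype
  -- Pigeonhole: two distinct elements send `w` to the same word, and `g⁻¹ * k` fixes it.
  obtain ⟨g, k, hne, heq⟩ := Finite.exists_ne_map_eq_of_infinite
    fun g : G => (⟨g.1.1 w, TreeAut.length_eq g.1 w⟩ : {v : List B // v.length = w.length})
  have heq' : g.1.1 w = k.1.1 w := congrArg Subtype.val heq
  refine ⟨g.1⁻¹ * k.1, G.mul_mem (G.inv_mem g.2) k.2, fun h => ?_, ?_⟩
  · exact hne (Subtype.ext (inv_mul_eq_one.1 h))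
  · change g.1.1⁻¹ (k.1.1 w) = w
    rw [← heq']
    exact Equiv.symm_apply_apply _ _

theorem dual_freeHom_injective [Finite Q] [Finite A] {M : Transducer Q A} (h : M.Bireversible)
    (hinf : Infinite (M.group h.invertible))
    (hstab : ∀ u : InfWord (A × Bool), EssentiallyNontrivial u → stabilizer h u = ⊥) :
    Function.Injective (M.dual.freeHom h.dual_invertible) := by
  by_contra hinj
  obtain ⟨L, hL, hcyc, hker⟩ := FreeGroup.exists_isCyclicallyReduced_of_not_injective _ hinj
  have hL' : L.reverse ≠ [] := by simpa using hL
  have htriv : L.reverse ∈ trivialWords h := by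
    intro v
    rw [List.reverse_reverse, ← freeHom_mk, hker]
    rfl
  have : Infinite ((M.enrich h.reversible).group h.enrich_invertible) :=
    (enrichEquiv h).toEquiv.infinite_iff.1 hinf
  obtain ⟨g, hgG, hg1, hgw⟩ :=
    exists_ne_one_fixing ((M.enrich h.reversible).group h.enrich_invertible) L.reverse
  have hfix : g • InfWord.periodic L.reverse hL' = InfWord.periodic L.reverse hL' := by
    apply TreeAut.smul_periodic
    intro v
    rw [(group_act_trivialWords h hgG _ htriv).2, hgw]
  have hbot := hstab _ (essentiallyNontrivial_of_isReduced _
    (hcyc.reverse.isReduced_periodic hL'))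
  -- `g` lives in the enriched group, whereas `stabilizer` is a subgroup of the original one.
  have hmem : (enrichEquiv h).symm ⟨g, hgG⟩ ∈
      stabilizer h (InfWord.periodic L.reverse hL') := by
    rw [stabilizer, Subgroup.mem_comap]
    change (enrichEquiv h) ((enrichEquiv h).symm ⟨g, hgG⟩) ∈ _
    rw [MulEquiv.apply_symm_apply]
    exact hfix
  rw [hbot, Subgroup.mem_bot, EmbeddingLike.map_eq_one_iff] at hmem
  exact hg1 (congrArg Subtype.val hmem)

end Transducer

/-- The states of the dual are the letters of `A`, and the image of `freeHom` is the generated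
group, so injectivity is all that is needed. -/
theorem mainTheorem7 {Q A : Type*} [Finite Q] [Finite A] (M : Transducer Q A)
    (hM : M.Bireversible) (hinf : Infinite (M.group hM.invertible))
    (hstab : ∀ u : InfWord (A × Bool), EssentiallyNontrivial u →
      Transducer.stabilizer hM u = ⊥) :
    Nonempty (M.dual.group hM.dual_invertible ≃* FreeGroup A) :=
  ⟨((MonoidHom.ofInjective (Transducer.dual_freeHom_injective hM hinf hstab)).trans
    (MulEquiv.subgroupCongr (M.dual.range_freeHom hM.dual_invertible))).symm⟩
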